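/- Let $k$ be an algebraically closed field of characteristic $p>0$, and let $U$ be a connected (in particular non-empty) reduced separated scheme of finite type over $k$. Let $\pi_1^{\mathrm{ab}}(U)$ be the maximal abelian profinite quotient of the étale fundamental group $\pi_1(U,\xi)$ at a geometric point $\xi$ of $U$. If $\pi_1^{\mathrm{ab}}(U)\otimes_{\mathbb Z}\mathbb F_p$ is finite, then $H^0(U,\mathcal O_U)=k$, i.e. the structure homomorphism $k\to H^0(U,\mathcal O_U)$ is an isomorphism. -/

import Mathlib

open CategoryTheory AlgebraicGeometry
open scoped TensorProduct

universe u

/-- Finite étale morphisms of schemes. -/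
def finiteEtaleMorphism : MorphismProperty Scheme.{u} :=
  fun _ _ f => IsFinite f ∧ Etale f

/-- The category of finite étale covers of a scheme `U`; morphisms are all morphisms over `U`. -/
abbrev FiniteEtaleCover (U : Scheme.{u}) : Type (u + 1) :=
  finiteEtaleMorphism.{u}.Over ⊤ U

namespace FiniteEtaleCover

variable {U : Scheme.{u}} {Ω : Type u} [Field Ω]

/-- The fibre of a finite étale cover `X → U` over a point `ξ : Spec Ω → U`:
the set of lifts of `ξ` to `X`. -/
def Fibre (ξ : Spec (.of Ω) ⟶ U) (X : FiniteEtaleCover U) : Type u :=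
  {s : Spec (.of Ω) ⟶ X.left // s ≫ X.hom = ξ}

theorem finite_lifts {X U : Scheme.{u}} (h : X ⟶ U) [IsFinite h] (ξ : Spec (.of Ω) ⟶ U) :
    Finite {s : Spec (.of Ω) ⟶ X // s ≫ h = ξ} := by
  let q := Limits.pullback.snd h ξ
  have hq : IsFinite q := inferInstance
  have : IsAffine (Limits.pullback h ξ) := isAffine_of_isAffineHom q
  let a : CommRingCat.of Ω ⟶ Γ(Limits.pullback h ξ, ⊤) :=
    (Scheme.ΓSpecIso (.of Ω)).inv ≫ q.appTop
  have ha : a.hom.Finite := by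
    have h1 : q.appTop.hom.Finite := q.finite_appTop
    have h2 : (Scheme.ΓSpecIso (.of Ω)).inv.hom.Finite :=
      RingHom.Finite.of_surjective _
        (ConcreteCategory.bijective_of_isIso (Scheme.ΓSpecIso (.of Ω)).inv).2
    exact h1.comp h2
  let : Algebra Ω Γ(Limits.pullback h ξ, ⊤) := a.hom.toAlgebra
  have : Module.Finite Ω Γ(Limits.pullback h ξ, ⊤) := ha
  let t (s : {s : Spec (.of Ω) ⟶ X // s ≫ h = ξ}) :
      Spec (.of Ω) ⟶ Limits.pullback h ξ :=
    Limits.pullback.lift s.1 (𝟙 _) (by simp [s.2])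
  have ht (s) : t s ≫ q = 𝟙 _ := Limits.pullback.lift_snd _ _ _
  let φ (s : {s : Spec (.of Ω) ⟶ X // s ≫ h = ξ}) : Γ(Limits.pullback h ξ, ⊤) →ₐ[Ω] Ω :=
    { ((t s).appTop ≫ (Scheme.ΓSpecIso (.of Ω)).hom).hom with
      commutes' := fun r => by
        have : a ≫ (t s).appTop ≫ (Scheme.ΓSpecIso (.of Ω)).hom = 𝟙 _ := by
          have := congrArg Scheme.Hom.appTop (ht s)
          simp only [Scheme.Hom.comp_appTop, Scheme.Hom.id_appTop] at this
          simp [a, reassoc_of% this]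
        exact congrArg (fun f => f.hom r) this }
  refine Finite.of_injective φ fun s₁ s₂ h12 => ?_
  have h3 : (t s₁).appTop ≫ (Scheme.ΓSpecIso (.of Ω)).hom =
      (t s₂).appTop ≫ (Scheme.ΓSpecIso (.of Ω)).hom := by
    ext x
    exact congrArg (fun f => f x) h12
  have h4 : t s₁ = t s₂ := ext_of_isAffine ((cancel_mono _).1 h3)
  have h5 := congrArg (· ≫ Limits.pullback.fst h ξ) h4
  simp only [t, Limits.pullback.lift_fst] at h5
  exact Subtype.ext h5

instance (ξ : Spec (.of Ω) ⟶ U) (X : FiniteEtaleCover U) : Finite (Fibre ξ X) :=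
  have : IsFinite X.hom := X.prop.1
  finite_lifts X.hom ξ

/-- The fibre functor at `ξ`, from finite étale covers of `U` to finite sets. -/
noncomputable def fibreFunctor (ξ : Spec (.of Ω) ⟶ U) : FiniteEtaleCover U ⥤ FintypeCat.{u} where
  obj X := .of (Fibre ξ X)
  map {X Y} f := FintypeCat.homMk fun s =>
    ⟨s.1 ≫ f.left, by rw [Category.assoc, Over.w f.hom]; exact s.2⟩
  map_id X := by
    ext s
    exact Subtype.ext (Category.comp_id _)
  map_comp f g := by
    ext s
    exact Subtype.ext (Category.assoc _ _ _).symm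

end FiniteEtaleCover

/-- The étale fundamental group `π₁(U, ξ)` of `U` at a geometric point `ξ`: the automorphism group
of the fibre functor. Mathlib equips it with the profinite topology, namely the coarsest one for
which the actions on all the (discrete) fibres are continuous. -/
abbrev EtaleFundamentalGroup {U : Scheme.{u}} {Ω : Type u} [Field Ω] [IsSepClosed Ω]
    (ξ : Spec (.of Ω) ⟶ U) : Type (u + 1) :=
  Aut (FiniteEtaleCover.fibreFunctor ξ)

/-- `π₁^ab(U, ξ)`, written additively: the maximal abelian (profinite) quotient of `π₁(U, ξ)`,
i.e. the quotient by the closure of the commutator subgroup. -/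
abbrev EtaleFundamentalGroupAb {U : Scheme.{u}} {Ω : Type u} [Field Ω] [IsSepClosed Ω]
    (ξ : Spec (.of Ω) ⟶ U) : Type (u + 1) :=
  Additive (TopologicalAbelianization (EtaleFundamentalGroup ξ))

/-- The structure homomorphism `k → H⁰(U, 𝒪_U)` of a `k`-scheme `f : U → Spec k`. -/
noncomputable def globalStructureMap {k : Type u} [Field k] {U : Scheme.{u}}
    (f : U ⟶ Spec (.of k)) : k →+* Γ(U, ⊤) :=
  ((Scheme.ΓSpecIso (.of k)).inv ≫ f.appTop).hom

/-!
Let `A = H⁰(U, 𝒪_U)`. The argument is that every `t ∈ A` outside `k` produces infinitely many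
Artin–Schreier characters of the fundamental group.

An element `a ∈ A` defines the finite étale cover `X_a : y ^ p - y = a` of `U`. The automorphisms of
the fibre functor commute with the translations `y ↦ y + m` of `X_a`, hence act on its fibre by
translations, which gives a continuous character `χ_a : π₁(U, ξ) → 𝔽_p`
(`exists_artinSchreierCharacter`). If `χ_a = χ_b`, the difference of a point of `X_a` and a point of
`X_b` is a point of the fibre of `X_{a - b}` fixed by `π₁(U, ξ)`. A cover with such a point has a
section (`exists_section_of_forall_aut_apply_eq`), so `a - b = r ^ p - r` for some `r ∈ A`. Hence
finiteness of `π₁^ab ⊗ 𝔽_p` forces `A / {r ^ p - r}` to be finite (`exists_separating_map`).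

The existence of sections is the fact from Galois theory that `π₁(U, ξ)` has enough elements. It is
proved without quotients of covers by finite groups: endomorphisms of the fibre functor are
compatible families of points over the cofiltered category of pointed covers, and they exist by
compactness (`exists_end_apply_ne`); endomorphisms are automatically invertible because the diagonal
of a cover is open and closed (`isIso_of_end`).

On the other hand, if `t` is not constant then it is transcendental over `k` on some affine open
`Spec B`, because `U` is connected and reduced. A closed point of the generic fibre of `t` on
`Spec B` has residue field `L` finite over `k(X)`. The solutions in `L` of `b ^ p - b = c t` for `c`
running through an `𝔽_p`-independent subset of `k` are linearly independent over `k(X)`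
(`linearIndependent_of_pow_sub_eq`), so this equation is solvable for only finitely many `c ∈ k`
(`finite_setOf_exists_pow_sub_eq`). As `k` is infinite, the elements `c t` then represent infinitely
many classes in `A / {r ^ p - r}`.
-/

/-! ### Geometric points of finite étale covers -/

section GeometricPoints

variable {Ω : Type u} [Field Ω]

/-- A nonempty finite étale scheme over a separably closed field is a disjoint union of copies of
its spectrum, so it has a rational point. -/
theorem exists_section_of_isSepClosed [IsSepClosed Ω] {P : Scheme.{u}} (q : P ⟶ Spec (.of Ω))
    [IsFinite q] [Etale q] [Nonempty P] : ∃ t : Spec (.of Ω) ⟶ P, t ≫ q = 𝟙 _ := by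
  have : IsAffine P := isAffine_of_isAffineHom q
  let a : CommRingCat.of Ω ⟶ Γ(P, ⊤) := (Scheme.ΓSpecIso (.of Ω)).inv ≫ q.appTop
  have ha : P.isoSpec.inv ≫ q = Spec.map a := by
    rw [Iso.inv_comp_eq, Spec.map_comp, Scheme.isoSpec_hom, ← Scheme.toSpecΓ_naturality_assoc]
    simp
  have het : a.hom.Etale := by
    have : Etale (Spec.map a) := by rw [← ha]; infer_instance
    exact HasRingHomProperty.Spec_iff.mp this
  let : Algebra Ω Γ(P, ⊤) := a.hom.toAlgebra
  have : Algebra.Etale Ω Γ(P, ⊤) := het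
  have hne : Nonempty (PrimeSpectrum Γ(P, ⊤)) := ‹Nonempty P›.map P.isoSpec.hom
  let g : Γ(P, ⊤) →ₐ[Ω] Ω := (Pi.evalAlgHom Ω (fun _ ↦ Ω) hne.some).comp
    (Algebra.FormallyEtale.equivPiOfIsSepClosed Ω Γ(P, ⊤)).toAlgHom
  refine ⟨Spec.map (CommRingCat.ofHom g.toRingHom) ≫ P.isoSpec.inv, ?_⟩
  rw [Category.assoc, ha, ← Spec.map_comp, ← Spec.map_id]
  congr 1
  ext r
  exact g.commutes r

/-- Geometric points lift along finite étale surjections. -/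
theorem exists_lift_of_isSepClosed [IsSepClosed Ω] {X Y : Scheme.{u}} (h : X ⟶ Y) [IsFinite h]
    [Etale h] [Surjective h] (s : Spec (.of Ω) ⟶ Y) : ∃ t : Spec (.of Ω) ⟶ X, t ≫ h = s := by
  let q := Limits.pullback.snd h s
  have : Nonempty ↥(Limits.pullback h s) :=
    ⟨(q.surjective (IsLocalRing.closedPoint Ω)).choose⟩
  obtain ⟨t, ht⟩ := exists_section_of_isSepClosed q
  refine ⟨t ≫ Limits.pullback.fst h s, ?_⟩
  rw [Category.assoc, Limits.pullback.condition, reassoc_of% ht]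

/-- A finite étale morphism is open and closed, so its image is everything if the target is
connected. -/
theorem surjective_of_finite_etale {X U : Scheme.{u}} (h : X ⟶ U) [IsFinite h] [Etale h]
    [ConnectedSpace U] [Nonempty X] : Surjective h := by
  have : IsClopen (Set.range h) := ⟨h.isClosedMap.isClosed_range, h.isOpenMap.isOpen_range⟩
  exact ⟨Set.range_eq_univ.mp (this.eq_univ (Set.range_nonempty _))⟩

theorem exists_geometricPoint [IsSepClosed Ω] {X U : Scheme.{u}} (h : X ⟶ U) [IsFinite h]
    [Etale h] [ConnectedSpace U] [Nonempty X] (ξ : Spec (.of Ω) ⟶ U) :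
    ∃ t : Spec (.of Ω) ⟶ X, t ≫ h = ξ :=
  have := surjective_of_finite_etale h
  exists_lift_of_isSepClosed h ξ

/-- The inclusion of an open and closed subscheme is a closed immersion, hence finite. -/
theorem isFinite_opens_ι {X : Scheme.{u}} (Z : X.Opens) (hZ : IsClosed (Z : Set X)) :
    IsFinite Z.ι :=
  have : IsClosedImmersion Z.ι := .of_isPreimmersion _ (by simpa using hZ)
  inferInstance

section OffDiagonal

variable {X U : Scheme.{u}} (h : X ⟶ U) [IsFinite h]

/-- The complement of the diagonal in `X ×_U X`, for `X` finite étale over `U`. -/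
noncomputable def offDiagonal : (Limits.pullback h h).Opens :=
  ⟨(Set.range (Limits.pullback.diagonal h))ᶜ,
    (Limits.pullback.diagonal h).isClosedMap.isClosed_range.isOpen_compl⟩

/-- The diagonal of a finite étale morphism is open, so its complement is closed. -/
theorem isClosed_offDiagonal [Etale h] : IsClosed (offDiagonal h : Set ↥(Limits.pullback h h)) :=
  (Limits.pullback.diagonal h).isOpenMap.isOpen_range.isClosed_compl

instance [Etale h] : IsFinite (offDiagonal h).ι := isFinite_opens_ι _ (isClosed_offDiagonal h)

theorem fst_ne_snd_of_offDiagonal (t : Spec (.of Ω) ⟶ (offDiagonal h).toScheme) :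
    t ≫ (offDiagonal h).ι ≫ Limits.pullback.fst h h ≠
      t ≫ (offDiagonal h).ι ≫ Limits.pullback.snd h h := by
  intro heq
  have hfac : t ≫ (offDiagonal h).ι =
      (t ≫ (offDiagonal h).ι ≫ Limits.pullback.snd h h) ≫ Limits.pullback.diagonal h := by
    apply Limits.pullback.hom_ext <;> simp [heq]
  have hz : (offDiagonal h).ι (t (IsLocalRing.closedPoint Ω)) ∈ offDiagonal h := by
    rw [← SetLike.mem_coe, ← Scheme.Opens.range_ι]
    exact Set.mem_range_self _
  refine hz ⟨(t ≫ (offDiagonal h).ι ≫ Limits.pullback.snd h h) (IsLocalRing.closedPoint Ω), ?_⟩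
  exact (congrArg (fun φ : Spec (.of Ω) ⟶ _ ↦ φ (IsLocalRing.closedPoint Ω)) hfac).symm

/-- A geometric point of `X ×_U X` with distinct coordinates factors through the complement of the
diagonal. -/
theorem exists_lift_offDiagonal [Etale h] (s : Spec (.of Ω) ⟶ Limits.pullback h h)
    (hs : s ≫ Limits.pullback.fst h h ≠ s ≫ Limits.pullback.snd h h) :
    ∃ t : Spec (.of Ω) ⟶ (offDiagonal h).toScheme, t ≫ (offDiagonal h).ι = s := by
  have hpt : ∀ x y : ↥(Spec (.of Ω)), x = y := fun x y ↦
    Subsingleton.elim (α := PrimeSpectrum Ω) x y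
  have : Set.range s ⊆ Set.range (offDiagonal h).ι := by
    rw [Scheme.Opens.range_ι]
    rintro _ ⟨x, rfl⟩ hx
    apply hs
    have hr : Set.range s ⊆ Set.range (Limits.pullback.diagonal h) := by
      rintro _ ⟨y, rfl⟩
      rwa [hpt y x]
    rw [← IsOpenImmersion.lift_fac (Limits.pullback.diagonal h) s hr, Category.assoc,
      Category.assoc, Limits.pullback.diagonal_fst, Limits.pullback.diagonal_snd]
  exact ⟨IsOpenImmersion.lift _ s this, IsOpenImmersion.lift_fac _ _ _⟩

end OffDiagonal

/-- A finite étale cover of a connected scheme with at most one geometric point over `ξ` is an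
isomorphism: its diagonal is surjective, so it is a surjective flat monomorphism. -/
theorem isIso_of_subsingleton_lifts [IsSepClosed Ω] {X U : Scheme.{u}} (h : X ⟶ U) [IsFinite h]
    [Etale h] [ConnectedSpace U] [Nonempty X] (ξ : Spec (.of Ω) ⟶ U)
    (H : ∀ s t : Spec (.of Ω) ⟶ X, s ≫ h = ξ → t ≫ h = ξ → s = t) : IsIso h := by
  have hWe : IsEmpty (offDiagonal h) := by
    by_contra hne
    rw [not_isEmpty_iff] at hne
    have : Nonempty (offDiagonal h).toScheme := hne
    obtain ⟨t, ht⟩ :=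
      exists_geometricPoint ((offDiagonal h).ι ≫ Limits.pullback.fst h h ≫ h) ξ
    refine fst_ne_snd_of_offDiagonal h t (H _ _ ?_ ?_)
    · simpa using ht
    · simpa [Limits.pullback.condition] using ht
  have hΔ : Surjective (Limits.pullback.diagonal h) := ⟨fun x ↦ by
    by_contra hx
    exact hWe.false ⟨x, hx⟩⟩
  have : IsIso (Limits.pullback.diagonal h) := Flat.isIso_of_surjective_of_mono _
  have : Mono h := (Limits.pullback.isIso_diagonal_iff h).mp this
  have := surjective_of_finite_etale h
  exact Flat.isIso_of_surjective_of_mono h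

end GeometricPoints

/-! ### Automorphisms of the fibre functor -/

namespace FiniteEtaleCover

variable {U : Scheme.{u}} {Ω : Type u} [Field Ω] {ξ : Spec (.of Ω) ⟶ U}

/-- The structure morphism `X → U` of a finite étale cover. -/
def toBase (X : FiniteEtaleCover U) : X.left ⟶ U := X.hom

instance (X : FiniteEtaleCover U) : IsFinite X.toBase := X.prop.1

instance (X : FiniteEtaleCover U) : Etale X.toBase := X.prop.2

theorem left_toBase {X Y : FiniteEtaleCover U} (f : X ⟶ Y) : f.left ≫ Y.toBase = X.toBase :=
  MorphismProperty.Over.w f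

/-- The cover given by a finite étale morphism. -/
abbrev ofHom {X : Scheme.{u}} (h : X ⟶ U) [hf : IsFinite h] [he : Etale h] : FiniteEtaleCover U :=
  MorphismProperty.Over.mk ⊤ h ⟨hf, he⟩

/-- A morphism of covers from a morphism of schemes over the base. -/
abbrev homMk {X Y : FiniteEtaleCover U} (f : X.left ⟶ Y.left) (w : f ≫ Y.toBase = X.toBase) :
    X ⟶ Y :=
  MorphismProperty.Over.homMk f w

/-- The morphism `Spec Ω → X` underlying an element of the fibre of `X`. -/
def point {X : FiniteEtaleCover U} (x : (fibreFunctor ξ).obj X) : Spec (.of Ω) ⟶ X.left :=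
  Subtype.val (p := fun s : Spec (.of Ω) ⟶ X.left ↦ s ≫ X.hom = ξ) x

theorem point_toBase {X : FiniteEtaleCover U} (x : (fibreFunctor ξ).obj X) :
    point x ≫ X.toBase = ξ :=
  Subtype.property (p := fun s : Spec (.of Ω) ⟶ X.left ↦ s ≫ X.hom = ξ) x

/-- The element of the fibre of `X` given by a morphism `Spec Ω → X` over `ξ`. -/
def ofPoint {X : FiniteEtaleCover U} (s : Spec (.of Ω) ⟶ X.left) (hs : s ≫ X.toBase = ξ) :
    (fibreFunctor ξ).obj X :=
  (⟨s, hs⟩ : Fibre ξ X)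

theorem point_injective {X : FiniteEtaleCover U} :
    Function.Injective (point : (fibreFunctor ξ).obj X → _) := Subtype.val_injective

/-- The fibre of the product `X ×_U Y` contains a point over any given pair of points. -/
theorem exists_cover_of_points {X Y : FiniteEtaleCover U} (x : (fibreFunctor ξ).obj X)
    (y : (fibreFunctor ξ).obj Y) :
    ∃ (P : FiniteEtaleCover U) (z : (fibreFunctor ξ).obj P) (f : P ⟶ X) (g : P ⟶ Y),
      (fibreFunctor ξ).map f z = x ∧ (fibreFunctor ξ).map g z = y := by
  have h : Limits.pullback.lift (point x) (point y) ((point_toBase x).trans (point_toBase y).symm) ≫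
      (Limits.pullback.fst X.toBase Y.toBase ≫ X.toBase) = ξ := by
    rw [Limits.pullback.lift_fst_assoc, point_toBase]
  refine ⟨ofHom (Limits.pullback.fst X.toBase Y.toBase ≫ X.toBase), ofPoint _ h,
    homMk (Limits.pullback.fst X.toBase Y.toBase) rfl,
    homMk (Limits.pullback.snd X.toBase Y.toBase) Limits.pullback.condition.symm, ?_, ?_⟩
  · exact point_injective (Limits.pullback.lift_fst _ _ _)
  · exact point_injective (Limits.pullback.lift_snd _ _ _)

/-- Two morphisms of covers that agree at a geometric point agree on a cover through which that
point factors: their equalizer is a base change of the diagonal of `Y`, hence finite étale. -/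
theorem exists_equalizing_cover {X Y : FiniteEtaleCover U} (x : (fibreFunctor ξ).obj X)
    (f g : X ⟶ Y) (hfg : (fibreFunctor ξ).map f x = (fibreFunctor ξ).map g x) :
    ∃ (E : FiniteEtaleCover U) (z : (fibreFunctor ξ).obj E) (e : E ⟶ X),
      (fibreFunctor ξ).map e z = x ∧ e ≫ f = e ≫ g := by
  have hfg' : point x ≫ f.left = point x ≫ g.left := congrArg point hfg
  let l : X.left ⟶ Limits.pullback Y.toBase Y.toBase :=
    Limits.pullback.lift f.left g.left ((left_toBase f).trans (left_toBase g).symm)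
  have hl1 : l ≫ Limits.pullback.fst _ _ = f.left := Limits.pullback.lift_fst _ _ _
  have hl2 : l ≫ Limits.pullback.snd _ _ = g.left := Limits.pullback.lift_snd _ _ _
  let e := Limits.pullback.fst l (Limits.pullback.diagonal Y.toBase)
  have he : e ≫ f.left = e ≫ g.left := by
    rw [← hl1, ← hl2, Limits.pullback.condition_assoc, Limits.pullback.condition_assoc]
    simp
  have : IsFinite e := inferInstanceAs (IsFinite (Limits.pullback.fst _ _))
  have : Etale e := inferInstanceAs (Etale (Limits.pullback.fst _ _))
  have hl : point x ≫ l = (point x ≫ f.left) ≫ Limits.pullback.diagonal Y.toBase := by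
    apply Limits.pullback.hom_ext
    · simp [hl1]
    · simp [hl2, hfg']
  have hz : Limits.pullback.lift (point x) _ hl ≫ (e ≫ X.toBase) = ξ := by
    rw [Limits.pullback.lift_fst_assoc, point_toBase]
  exact ⟨ofHom (e ≫ X.toBase), ofPoint _ hz, homMk e rfl,
    point_injective (Limits.pullback.lift_fst _ _ _), MorphismProperty.Over.Hom.ext he⟩

variable (ξ) in
/-- The category of pointed finite étale covers: covers with a geometric point over `ξ`. -/
abbrev Pointed : Type (u + 1) := (fibreFunctor ξ ⋙ FintypeCat.incl).Elements

instance : IsCofiltered (Pointed ξ) where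
  nonempty := ⟨⟨ofHom (𝟙 U), ofPoint ξ (Category.comp_id _)⟩⟩
  cone_objs i j := by
    obtain ⟨P, z, f, g, hf, hg⟩ := exists_cover_of_points (ξ := ξ) i.2 j.2
    exact ⟨⟨P, z⟩, ⟨f, hf⟩, ⟨g, hg⟩, trivial⟩
  cone_maps i j f g := by
    obtain ⟨E, z, e, hz, he⟩ := exists_equalizing_cover (ξ := ξ) i.2 f.1 g.1 (f.2.trans g.2.symm)
    exact ⟨⟨E, z⟩, ⟨e, hz⟩, Subtype.ext he⟩

/-- If every pointed cover of `(X, x)` has a point of its fibre that does not lie over `x`, then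
some endomorphism of the fibre functor moves `x`. Endomorphisms are the families `σ` of points, one
for each pointed cover, that are compatible with all morphisms; they exist by compactness, since
finitely many compatibilities can be arranged on a single pointed cover. -/
theorem exists_end_apply_ne (X : FiniteEtaleCover U) (x : (fibreFunctor ξ).obj X)
    (H : ∀ (C : FiniteEtaleCover U) (c : (fibreFunctor ξ).obj C) (h : C ⟶ X),
      (fibreFunctor ξ).map h c = x → ∃ c', (fibreFunctor ξ).map h c' ≠ x) :
    ∃ σ : fibreFunctor ξ ⟶ fibreFunctor ξ, σ.app X x ≠ x := by
  classical
  let F := fibreFunctor ξ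
  let : ∀ j : Pointed ξ, TopologicalSpace (F.obj j.1) := fun _ ↦ ⊥
  have : ∀ j : Pointed ξ, DiscreteTopology (F.obj j.1) := fun _ ↦ ⟨rfl⟩
  let j₀ : Pointed ξ := ⟨X, x⟩
  let S : Set (∀ j : Pointed ξ, F.obj j.1) := {s | s j₀ ≠ x}
  let T (m : Σ i j : Pointed ξ, i ⟶ j) : Set (∀ j : Pointed ξ, F.obj j.1) :=
    {s | F.map m.2.2.1 (s m.1) = s m.2.1}
  have hS : IsCompact S := by
    apply IsClosed.isCompact
    have h := continuous_apply (A := fun j : Pointed ξ ↦ F.obj j.1) j₀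
    exact IsClosed.preimage h (isClosed_discrete {y : F.obj j₀.1 | y ≠ x})
  have hT : ∀ m, IsClosed (T m) := fun m ↦
    isClosed_eq ((continuous_of_discreteTopology (f := F.map m.2.2.1)).comp (continuous_apply _))
      (continuous_apply _)
  obtain ⟨s, hs, hsT⟩ := hS.inter_iInter_nonempty T hT fun u ↦ by
    -- a pointed cover `C` mapping compatibly to all the objects involved in `u`
    let O : Finset (Pointed ξ) :=
      insert j₀ (u.image (fun m ↦ m.1) ∪ u.image (fun m ↦ m.2.1))
    have h1 : ∀ m ∈ u, m.1 ∈ O := fun m hm ↦ Finset.mem_insert_of_mem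
      (Finset.mem_union_left _ (Finset.mem_image_of_mem _ hm))
    have h2 : ∀ m ∈ u, m.2.1 ∈ O := fun m hm ↦ Finset.mem_insert_of_mem
      (Finset.mem_union_right _ (Finset.mem_image_of_mem (fun m ↦ m.2.1) hm))
    let M : Finset (Σ' (i j : Pointed ξ) (_ : i ∈ O) (_ : j ∈ O), i ⟶ j) :=
      u.attach.image fun m ↦ ⟨m.1.1, m.1.2.1, h1 _ m.2, h2 _ m.2, m.1.2.2⟩
    obtain ⟨C, t, ht⟩ := IsCofiltered.inf_exists O M
    have h0 : j₀ ∈ O := Finset.mem_insert_self _ _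
    obtain ⟨c', hc'⟩ := H C.1 C.2 (t h0).1 (t h0).2
    -- a point `c'` of `C` not lying over `x` induces a point on all of them; the value outside `O`
    -- is irrelevant
    refine ⟨fun j ↦ if hj : j ∈ O then F.map (t hj).1 c' else j.2, ?_, ?_⟩
    · simpa [S, h0] using hc'
    · simp only [Set.mem_iInter]
      intro m hm
      have := ht (h1 m hm) (h2 m hm) (f := m.2.2)
        (Finset.mem_image.mpr ⟨⟨m, hm⟩, Finset.mem_attach _ _, rfl⟩)
      simp only [T, Set.mem_ofPred_eq, h1 m hm, h2 m hm, dif_pos, ← this]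
      simp
  simp only [Set.mem_iInter] at hsT
  refine ⟨{ app Y := FintypeCat.homMk fun y ↦ s ⟨Y, y⟩, naturality Y Z f := ?_ }, hs⟩
  ext y
  exact (hsT ⟨⟨Y, y⟩, ⟨Z, F.map f y⟩, ⟨f, rfl⟩⟩).symm

/-- Every endomorphism of the fibre functor is invertible: it preserves the complement of the
diagonal of `Y ×_U Y`, so it is injective on the finite fibre of `Y`. -/
theorem isIso_of_end (σ : fibreFunctor ξ ⟶ fibreFunctor ξ) : IsIso σ := by
  have (Y : FiniteEtaleCover U) : IsIso (σ.app Y) := by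
    rw [ConcreteCategory.isIso_iff_bijective]
    refine Finite.injective_iff_bijective.mp fun y y' hyy ↦ ?_
    by_contra hne
    let W := offDiagonal Y.toBase
    let p := W.ι ≫ Limits.pullback.fst Y.toBase Y.toBase
    let q := W.ι ≫ Limits.pullback.snd Y.toBase Y.toBase
    have : IsFinite p := inferInstanceAs (IsFinite (_ ≫ _))
    have : Etale p := inferInstanceAs (Etale (_ ≫ _))
    have hpq : q ≫ Y.toBase = p ≫ Y.toBase := by
      simp only [p, q, Category.assoc, Limits.pullback.condition]
    let D : FiniteEtaleCover U := ofHom (p ≫ Y.toBase)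
    let a : D ⟶ Y := homMk p rfl
    let b : D ⟶ Y := homMk q hpq
    let l := Limits.pullback.lift (point y) (point y')
      ((point_toBase y).trans (point_toBase y').symm)
    have hl1 : l ≫ Limits.pullback.fst _ _ = point y := Limits.pullback.lift_fst _ _ _
    have hl2 : l ≫ Limits.pullback.snd _ _ = point y' := Limits.pullback.lift_snd _ _ _
    obtain ⟨t, ht⟩ := exists_lift_offDiagonal Y.toBase l
      (by rw [hl1, hl2]; exact fun h ↦ hne (point_injective h))
    have htp : t ≫ p = point y := by rw [← hl1, ← ht, Category.assoc]
    have htq : t ≫ q = point y' := by rw [← hl2, ← ht, Category.assoc]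
    have hd : t ≫ p ≫ Y.toBase = ξ := by rw [reassoc_of% htp, point_toBase]
    let d : (fibreFunctor ξ).obj D := ofPoint t hd
    have hda : (fibreFunctor ξ).map a d = y := point_injective htp
    have hdb : (fibreFunctor ξ).map b d = y' := point_injective htq
    have h : (fibreFunctor ξ).map a (σ.app D d) = (fibreFunctor ξ).map b (σ.app D d) := by
      rw [← NatTrans.naturality_apply, ← NatTrans.naturality_apply, hda, hdb, hyy]
    exact fst_ne_snd_of_offDiagonal Y.toBase (point (σ.app D d)) (congrArg point h)
  exact NatIso.isIso_of_isIso_app σ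

/-- A cover with a point in its fibre that is fixed by the whole fundamental group has a section.
Some pointed cover `C → X` then has its whole fibre over that point, and the image of `C` is an open
and closed subscheme of `X` that maps isomorphically to `U`. -/
theorem exists_section_of_forall_aut_apply_eq [IsSepClosed Ω] [ConnectedSpace U]
    (X : FiniteEtaleCover U) (x : (fibreFunctor ξ).obj X)
    (hx : ∀ σ : Aut (fibreFunctor ξ), σ.hom.app X x = x) :
    ∃ s : U ⟶ X.left, s ≫ X.toBase = 𝟙 U := by
  by_cases H : ∀ (C : FiniteEtaleCover U) (c : (fibreFunctor ξ).obj C) (h : C ⟶ X),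
      (fibreFunctor ξ).map h c = x → ∃ c', (fibreFunctor ξ).map h c' ≠ x
  · obtain ⟨σ, hσ⟩ := exists_end_apply_ne X x H
    have := isIso_of_end σ
    exact absurd (hx (asIso σ)) hσ
  push Not at H
  obtain ⟨C, c, h, hc, hall⟩ := H
  have hw : h.left ≫ X.toBase = C.toBase := left_toBase h
  have : IsFinite (h.left ≫ X.toBase) := hw ▸ inferInstance
  have : Etale (h.left ≫ X.toBase) := hw ▸ inferInstance
  have : IsFinite h.left := .of_comp _ X.toBase
  have : Etale h.left := .of_comp _ X.toBase
  -- the image of `C` in `X` is an open and closed subscheme whose only geometric point is `x`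
  let Z : X.left.Opens := ⟨Set.range h.left, h.left.isOpenMap.isOpen_range⟩
  have hZ : IsClosed (Z : Set X.left) := h.left.isClosedMap.isClosed_range
  have := isFinite_opens_ι Z hZ
  let g : C.left ⟶ Z.toScheme := IsOpenImmersion.lift Z.ι h.left (by simp [Z])
  have hg : g ≫ Z.ι = h.left := IsOpenImmersion.lift_fac _ _ _
  have : IsFinite (g ≫ Z.ι) := hg ▸ inferInstance
  have : Etale (g ≫ Z.ι) := hg ▸ inferInstance
  have : IsFinite g := .of_comp _ Z.ι
  have : Etale g := .of_comp _ Z.ι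
  have : Surjective g := ⟨fun z ↦ by
    obtain ⟨y, hy⟩ : Z.ι z ∈ Set.range h.left := by
      have : Z.ι z ∈ Set.range Z.ι := ⟨z, rfl⟩
      rwa [Scheme.Opens.range_ι] at this
    refine ⟨y, Z.ι.injective ?_⟩
    rw [← Scheme.Hom.comp_apply, hg, hy]⟩
  have : Nonempty Z.toScheme :=
    ⟨g (point c (IsLocalRing.closedPoint Ω))⟩
  have key : ∀ s : Spec (.of Ω) ⟶ Z.toScheme, s ≫ Z.ι ≫ X.toBase = ξ →
      s ≫ Z.ι = point x := by
    intro s hs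
    obtain ⟨t, ht⟩ := exists_lift_of_isSepClosed g s
    have htξ : t ≫ C.toBase = ξ := by rw [← hw, ← hg, Category.assoc, reassoc_of% ht, hs]
    rw [← ht, Category.assoc, hg]
    exact congrArg point (hall (ofPoint t htξ))
  have : IsIso (Z.ι ≫ X.toBase) := isIso_of_subsingleton_lifts _ ξ fun s t hs ht ↦ by
    rw [← cancel_mono Z.ι, key s hs, key t ht]
  exact ⟨inv (Z.ι ≫ X.toBase) ≫ Z.ι, by simp⟩

end FiniteEtaleCover

/-! ### The Artin–Schreier equation -/

section ArtinSchreierAlgebra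

variable {A : Type u} [CommRing A] (p : ℕ) [Fact p.Prime]

theorem sub_pow_sub_sub_of_natCast_eq_zero (hp : (p : A) = 0) (x y : A) :
    (x - y) ^ p - (x - y) = (x ^ p - x) - (y ^ p - y) := by
  obtain ⟨r, hr⟩ := exists_add_pow_prime_eq (Fact.out : p.Prime) (x - y) y
  rw [hp, zero_mul, zero_mul, zero_mul, add_zero, sub_add_cancel] at hr
  rw [hr]
  ring

theorem intCast_pow_of_natCast_eq_zero (hp : (p : A) = 0) (m : ℤ) : (m : A) ^ p = m := by
  have hdvd : (p : ℤ) ∣ m ^ p - m := by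
    rw [← ZMod.intCast_eq_intCast_iff_dvd_sub]
    push_cast
    exact (ZMod.pow_card (m : ZMod p)).symm
  obtain ⟨c, hc⟩ := hdvd
  have := congrArg (Int.cast : ℤ → A) hc
  push_cast at this
  rwa [hp, zero_mul, sub_eq_zero] at this

open Polynomial in
/-- The Artin–Schreier algebra `A[y] / (y ^ p - y - a)` over a ring with `p = 0`, as a standard
étale algebra: the derivative of the equation is `-1`, so nothing has to be inverted. -/
noncomputable def artinSchreierPair (hp : (p : A) = 0) (a : A) : StandardEtalePair A where
  f := X ^ p - X - C a
  monic_f := by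
    have h1 : 1 < p := (Fact.out : p.Prime).one_lt
    rw [sub_sub]
    refine monic_X_pow_sub (n := p) ?_
    refine (degree_add_le _ _).trans_lt (max_lt ?_ ?_)
    · exact degree_X_le.trans_lt (by exact_mod_cast h1)
    · exact degree_C_le.trans_lt (by exact_mod_cast h1.le)
  g := 1
  cond := ⟨-1, 0, 0, by
    have h : derivative (X ^ p : A[X]) = 0 := by rw [derivative_X_pow, hp, C_0, zero_mul]
    simp [h]⟩

variable (hp : (p : A) = 0) (a : A)

theorem artinSchreierPair_hasMap_iff {S : Type*} [CommRing S] [Algebra A S] (y : S) :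
    (artinSchreierPair p hp a).HasMap y ↔ y ^ p - y = algebraMap A S a := by
  simp [StandardEtalePair.HasMap, artinSchreierPair, sub_eq_zero]

instance : Module.Finite A (artinSchreierPair p hp a).Ring := by
  have := (artinSchreierPair p hp a).monic_f.finite_adjoinRoot
  have hu : IsUnit (AdjoinRoot.mk (artinSchreierPair p hp a).f (artinSchreierPair p hp a).g) :=
    isUnit_one.map _
  exact Module.Finite.equiv (((IsLocalization.atUnit _ (Localization.Away _) _ hu).restrictScalars
    A).trans (artinSchreierPair p hp a).equivAwayAdjoinRoot.symm).toLinearEquiv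

end ArtinSchreierAlgebra

/-! ### Artin–Schreier covers of a scheme -/

section ArtinSchreierCover

variable {U : Scheme.{u}} (p : ℕ) [Fact p.Prime] (hp : (p : Γ(U, ⊤)) = 0) (a : Γ(U, ⊤))

/-- The morphism `Spec A[y] / (y ^ p - y - a) → Spec A` for `A = H⁰(U, 𝒪_U)`. -/
noncomputable def artinSchreierSpec :
    Spec (.of (artinSchreierPair p hp a).Ring) ⟶ Spec Γ(U, ⊤) :=
  Spec.map (CommRingCat.ofHom (algebraMap Γ(U, ⊤) (artinSchreierPair p hp a).Ring))

instance : IsFinite (artinSchreierSpec p hp a) := by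
  rw [artinSchreierSpec, IsFinite.SpecMap_iff]
  exact RingHom.finite_algebraMap.mpr inferInstance

instance : Etale (artinSchreierSpec p hp a) :=
  HasRingHomProperty.Spec_iff.mpr (RingHom.etale_algebraMap.mpr inferInstance)

open FiniteEtaleCover

/-- The Artin–Schreier cover `y ^ p - y = a` of `U`, the base change to `U` of the corresponding
cover of `Spec H⁰(U, 𝒪_U)`. -/
noncomputable def artinSchreierCover : FiniteEtaleCover U :=
  ofHom (Limits.pullback.fst U.toSpecΓ (artinSchreierSpec p hp a))

/-- The coordinate function `y` on the Artin–Schreier cover. -/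
noncomputable def artinSchreierCoord : Γ((artinSchreierCover p hp a).left, ⊤) :=
  ((Scheme.ΓSpecIso (.of (artinSchreierPair p hp a).Ring)).inv ≫
    (Limits.pullback.snd U.toSpecΓ (artinSchreierSpec p hp a)).appTop).hom
      (artinSchreierPair p hp a).X

/-- A morphism to the fibre product restricts along `A → A[y] / (y ^ p - y - a)` to the pullback of
functions from `U`. -/
theorem artinSchreier_structureMap_eq {T : Scheme.{u}}
    (g : T ⟶ Limits.pullback U.toSpecΓ (artinSchreierSpec p hp a)) :
    CommRingCat.ofHom (algebraMap Γ(U, ⊤) (artinSchreierPair p hp a).Ring) ≫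
      (Scheme.ΓSpecIso _).inv ≫ (g ≫ Limits.pullback.snd _ _).appTop =
      (g ≫ Limits.pullback.fst _ _).appTop := by
  rw [Scheme.ΓSpecIso_inv_naturality_assoc]
  change (Scheme.ΓSpecIso Γ(U, ⊤)).inv ≫ (artinSchreierSpec p hp a).appTop ≫ _ = _
  rw [← Scheme.Hom.comp_appTop, Category.assoc, ← Limits.pullback.condition, ← Category.assoc,
    Scheme.Hom.comp_appTop, Scheme.toSpecΓ_appTop, Iso.inv_hom_id_assoc]

theorem artinSchreierCoord_pow_sub :
    artinSchreierCoord p hp a ^ p - artinSchreierCoord p hp a =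
      (artinSchreierCover p hp a).toBase.appTop a := by
  have h := artinSchreier_structureMap_eq p hp a (𝟙 _)
  rw [Category.id_comp, Category.id_comp] at h
  have h2 := congrArg (fun φ ↦ φ.hom a) h
  refine Eq.trans ?_ h2
  have := (artinSchreierPair_hasMap_iff p hp a _).mp (artinSchreierPair p hp a).hasMap_X
  let ρ : (artinSchreierPair p hp a).Ring →+* Γ(Limits.pullback U.toSpecΓ _, ⊤) :=
    ((Scheme.ΓSpecIso (.of (artinSchreierPair p hp a).Ring)).inv ≫
      (Limits.pullback.snd U.toSpecΓ (artinSchreierSpec p hp a)).appTop).hom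
  change ρ _ ^ p - ρ _ = ρ (algebraMap _ _ a)
  rw [← map_pow, ← map_sub, this]

theorem artinSchreierCover_hom_ext {T : Scheme.{u}} {f g : T ⟶ (artinSchreierCover p hp a).left}
    (h : f ≫ (artinSchreierCover p hp a).toBase = g ≫ (artinSchreierCover p hp a).toBase)
    (h' : f.appTop (artinSchreierCoord p hp a) = g.appTop (artinSchreierCoord p hp a)) :
    f = g := by
  apply Limits.pullback.hom_ext h
  apply ext_of_isAffine
  rw [← cancel_epi (Scheme.ΓSpecIso (.of (artinSchreierPair p hp a).Ring)).inv]
  let := (f ≫ (artinSchreierCover p hp a).toBase).appTop.hom.toAlgebra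
  let φ : (artinSchreierPair p hp a).Ring →ₐ[Γ(U, ⊤)] Γ(T, ⊤) :=
    { ((Scheme.ΓSpecIso (.of (artinSchreierPair p hp a).Ring)).inv ≫
        (f ≫ Limits.pullback.snd _ _).appTop).hom with
      commutes' := fun r ↦ congrArg (fun φ ↦ φ.hom r) (artinSchreier_structureMap_eq p hp a f) }
  let ψ : (artinSchreierPair p hp a).Ring →ₐ[Γ(U, ⊤)] Γ(T, ⊤) :=
    { ((Scheme.ΓSpecIso (.of (artinSchreierPair p hp a).Ring)).inv ≫
        (g ≫ Limits.pullback.snd _ _).appTop).hom with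
      commutes' := fun r ↦ congrArg (fun φ ↦ φ.hom r)
        ((artinSchreier_structureMap_eq p hp a g).trans (congrArg Scheme.Hom.appTop h.symm)) }
  have hφψ : φ = ψ := (artinSchreierPair p hp a).hom_ext h'
  ext r
  exact congrArg (fun φ ↦ φ r) hφψ

/-- With `artinSchreierCover_hom_ext`: morphisms over `U` to the Artin–Schreier cover correspond to
solutions of its equation. -/
theorem exists_lift_artinSchreierCover {T : Scheme.{u}} (φ : T ⟶ U) (b : Γ(T, ⊤))
    (hb : b ^ p - b = φ.appTop a) :
    ∃ g : T ⟶ (artinSchreierCover p hp a).left, g ≫ (artinSchreierCover p hp a).toBase = φ ∧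
      g.appTop (artinSchreierCoord p hp a) = b := by
  let := φ.appTop.hom.toAlgebra
  have hm : (artinSchreierPair p hp a).HasMap b := (artinSchreierPair_hasMap_iff p hp a b).mpr hb
  let ρ := (artinSchreierPair p hp a).lift b hm
  let r : CommRingCat.of (artinSchreierPair p hp a).Ring ⟶ Γ(T, ⊤) :=
    CommRingCat.ofHom ρ.toRingHom
  have hr : CommRingCat.ofHom (algebraMap Γ(U, ⊤) (artinSchreierPair p hp a).Ring) ≫ r =
      φ.appTop := by
    ext x
    exact ρ.commutes x
  have hw : φ ≫ U.toSpecΓ = (T.toSpecΓ ≫ Spec.map r) ≫ artinSchreierSpec p hp a := by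
    rw [Scheme.toSpecΓ_naturality, Category.assoc, artinSchreierSpec, ← Spec.map_comp, hr]
  refine ⟨Limits.pullback.lift φ (T.toSpecΓ ≫ Spec.map r) hw, Limits.pullback.lift_fst _ _ _, ?_⟩
  have h : (Scheme.ΓSpecIso (.of (artinSchreierPair p hp a).Ring)).inv ≫
      (Limits.pullback.lift φ (T.toSpecΓ ≫ Spec.map r) hw ≫ Limits.pullback.snd _ _).appTop =
        r := by
    rw [Limits.pullback.lift_snd, Scheme.Hom.comp_appTop, ← Scheme.ΓSpecIso_inv_naturality_assoc,
      Scheme.toSpecΓ_appTop, Iso.inv_hom_id, Category.comp_id]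
  exact (congrArg (fun φ ↦ φ.hom (artinSchreierPair p hp a).X) h).trans
    ((artinSchreierPair p hp a).lift_X b hm)

end ArtinSchreierCover

/-! ### The characters of the fundamental group attached to Artin–Schreier covers -/

namespace FiniteEtaleCover

section Eval

variable {U : Scheme.{u}} {Ω : Type u} [Field Ω] {ξ : Spec (.of Ω) ⟶ U}

/-- Evaluation of global functions at a morphism `Spec Ω → X`. -/
noncomputable def evalAt {X : Scheme.{u}} (s : Spec (.of Ω) ⟶ X) : Γ(X, ⊤) →+* Ω :=
  (s.appTop ≫ (Scheme.ΓSpecIso (.of Ω)).hom).hom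

theorem evalAt_comp {X Y : Scheme.{u}} (s : Spec (.of Ω) ⟶ X) (f : X ⟶ Y) (b : Γ(Y, ⊤)) :
    evalAt (s ≫ f) b = evalAt s (f.appTop b) := by
  rw [evalAt, Scheme.Hom.comp_appTop]
  rfl

theorem evalAt_point_map {X Y : FiniteEtaleCover U} (f : X ⟶ Y) (x : (fibreFunctor ξ).obj X)
    (b : Γ(Y.left, ⊤)) :
    evalAt (point ((fibreFunctor ξ).map f x)) b = evalAt (point x) (f.left.appTop b) :=
  evalAt_comp _ _ _

theorem natCast_eq_zero_of_ringHom (p : ℕ) {A B : Type*} [CommRing A] [CommRing B] (φ : A →+* B)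
    (hp : (p : A) = 0) : (p : B) = 0 := by
  rw [← map_natCast φ, hp, map_zero]

theorem appTop_left_toBase {X Y : FiniteEtaleCover U} (f : X ⟶ Y) (c : Γ(U, ⊤)) :
    f.left.appTop (Y.toBase.appTop c) = X.toBase.appTop c := by
  rw [← left_toBase f, Scheme.Hom.comp_appTop]
  rfl

variable (p : ℕ) [Fact p.Prime] (hp : (p : Γ(U, ⊤)) = 0) (a : Γ(U, ⊤))

/-- The value of the Artin–Schreier coordinate at a point of the fibre. -/
noncomputable def coordAt (x : (fibreFunctor ξ).obj (artinSchreierCover p hp a)) : Ω :=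
  evalAt (point x) (artinSchreierCoord p hp a)

theorem coordAt_pow_sub (x : (fibreFunctor ξ).obj (artinSchreierCover p hp a)) :
    coordAt p hp a x ^ p - coordAt p hp a x = evalAt ξ a := by
  rw [coordAt, ← map_pow, ← map_sub, artinSchreierCoord_pow_sub, ← evalAt_comp, point_toBase]

theorem coordAt_injective :
    Function.Injective (coordAt p hp a : (fibreFunctor ξ).obj (artinSchreierCover p hp a) → Ω) := by
  intro x y h
  apply point_injective
  apply artinSchreierCover_hom_ext
  · rw [point_toBase, point_toBase]
  · exact (ConcreteCategory.bijective_of_isIso (Scheme.ΓSpecIso (.of Ω)).hom).1 (by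
      simpa [coordAt, evalAt] using h)

/-- The morphism to the Artin–Schreier cover given by a solution of its equation. -/
theorem exists_hom_artinSchreierCover {X : FiniteEtaleCover U} (b : Γ(X.left, ⊤))
    (hb : b ^ p - b = X.toBase.appTop a) :
    ∃ f : X ⟶ artinSchreierCover p hp a, ∀ x : (fibreFunctor ξ).obj X,
      coordAt p hp a ((fibreFunctor ξ).map f x) = evalAt (point x) b := by
  obtain ⟨g, hg, hgb⟩ := exists_lift_artinSchreierCover p hp a X.toBase b hb
  refine ⟨homMk g hg, fun x ↦ ?_⟩
  rw [coordAt, evalAt_point_map, ← hgb]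
  rfl

/-- Two points of the fibre of an Artin–Schreier cover differ by an element of `𝔽_p`. -/
theorem exists_intCast_eq_coordAt_sub
    (x x' : (fibreFunctor ξ).obj (artinSchreierCover p hp a)) :
    ∃ m : ℤ, (m : Ω) = coordAt p hp a x - coordAt p hp a x' := by
  have hΩ := natCast_eq_zero_of_ringHom p (evalAt ξ) hp
  have : CharP Ω p := (CharP.charP_iff_prime_eq_zero Fact.out).mpr hΩ
  rw [← mem_bot_iff_intCast p Ω, Subfield.mem_bot_iff_pow_eq_self (F := Ω) (p := p),
    ← sub_eq_zero, sub_pow_sub_sub_of_natCast_eq_zero p hΩ, coordAt_pow_sub, coordAt_pow_sub,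
    sub_self]

/-- An automorphism of the fibre functor moves all points of the fibre of an Artin–Schreier cover
by the same translation, because it commutes with the automorphisms `y ↦ y - m` of the cover. -/
theorem coordAt_app_sub_coordAt (σ : fibreFunctor ξ ⟶ fibreFunctor ξ)
    (x x' : (fibreFunctor ξ).obj (artinSchreierCover p hp a)) :
    coordAt p hp a (σ.app _ x) - coordAt p hp a x =
      coordAt p hp a (σ.app _ x') - coordAt p hp a x' := by
  obtain ⟨m, hm⟩ := exists_intCast_eq_coordAt_sub p hp a x x'
  have hΓ := natCast_eq_zero_of_ringHom p (artinSchreierCover p hp a).toBase.appTop.hom hp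
  obtain ⟨f, hf⟩ := exists_hom_artinSchreierCover (ξ := ξ) p hp a
    (artinSchreierCoord p hp a - (m : Γ((artinSchreierCover p hp a).left, ⊤))) (by
      rw [sub_pow_sub_sub_of_natCast_eq_zero p hΓ, artinSchreierCoord_pow_sub,
        intCast_pow_of_natCast_eq_zero p hΓ, sub_self, sub_zero])
  have hf' (z : (fibreFunctor ξ).obj (artinSchreierCover p hp a)) :
      coordAt p hp a ((fibreFunctor ξ).map f z) = coordAt p hp a z - m := by
    rw [hf, map_sub, map_intCast, coordAt]
  have hx : (fibreFunctor ξ).map f x = x' := by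
    apply coordAt_injective
    rw [hf', hm, sub_sub_cancel]
  rw [← hx, NatTrans.naturality_apply, hf', hf', sub_sub_sub_cancel_right]

/-- Subtraction of coordinates is a map of covers `X_a ×_U X_b → X_{a - b}`, so it is compatible
with the action on the fibres. -/
theorem exists_coordAt_eq_sub (b : Γ(U, ⊤))
    (x : (fibreFunctor ξ).obj (artinSchreierCover p hp a))
    (y : (fibreFunctor ξ).obj (artinSchreierCover p hp b)) :
    ∃ z : (fibreFunctor ξ).obj (artinSchreierCover p hp (a - b)),
      ∀ σ : fibreFunctor ξ ⟶ fibreFunctor ξ, coordAt p hp (a - b) (σ.app _ z) =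
        coordAt p hp a (σ.app _ x) - coordAt p hp b (σ.app _ y) := by
  obtain ⟨P, w, f, g, rfl, rfl⟩ := exists_cover_of_points x y
  have hΓ := natCast_eq_zero_of_ringHom p P.toBase.appTop.hom hp
  obtain ⟨d, hd⟩ := exists_hom_artinSchreierCover (ξ := ξ) p hp (a - b) (X := P)
    (f.left.appTop (artinSchreierCoord p hp a) - g.left.appTop (artinSchreierCoord p hp b)) (by
      rw [sub_pow_sub_sub_of_natCast_eq_zero p hΓ, ← map_pow, ← map_sub, ← map_pow, ← map_sub,
        artinSchreierCoord_pow_sub, artinSchreierCoord_pow_sub, map_sub,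
        appTop_left_toBase, appTop_left_toBase])
  refine ⟨(fibreFunctor ξ).map d w, fun σ ↦ ?_⟩
  rw [NatTrans.naturality_apply, NatTrans.naturality_apply, NatTrans.naturality_apply, hd,
    map_sub, ← evalAt_point_map, ← evalAt_point_map, coordAt, coordAt]

theorem nonempty_fibre_artinSchreierCover [IsSepClosed Ω] :
    Nonempty ((fibreFunctor ξ).obj (artinSchreierCover p hp a)) := by
  have hΩ := natCast_eq_zero_of_ringHom p (evalAt ξ) hp
  obtain ⟨y, hy⟩ := IsSepClosed.exists_root_C_mul_X_pow_add_C_mul_X_add_C 1 (-1) (-evalAt ξ a) hΩ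
    (Fact.out : p.Prime).two_le (neg_ne_zero.mpr one_ne_zero)
  have hy' : y ^ p - y = evalAt ξ a := by linear_combination hy
  obtain ⟨g, hg, -⟩ := exists_lift_artinSchreierCover p hp a ξ
    ((Scheme.ΓSpecIso (.of Ω)).inv.hom y) (by
      rw [← map_pow, ← map_sub, hy']
      exact congrArg (fun φ ↦ φ.hom (ξ.appTop a)) (Scheme.ΓSpecIso (.of Ω)).hom_inv_id)
  exact ⟨ofPoint g hg⟩

/-- The section of an Artin–Schreier cover obtained from a fixed point of the fundamental group is a
global solution of the Artin–Schreier equation. -/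
theorem exists_pow_sub_eq_of_forall_coordAt_eq [IsSepClosed Ω] [ConnectedSpace U]
    (z : (fibreFunctor ξ).obj (artinSchreierCover p hp a))
    (hz : ∀ σ : Aut (fibreFunctor ξ), coordAt p hp a (σ.hom.app _ z) = coordAt p hp a z) :
    ∃ r : Γ(U, ⊤), r ^ p - r = a := by
  obtain ⟨s, hs⟩ := exists_section_of_forall_aut_apply_eq _ z
    fun σ ↦ coordAt_injective p hp a (hz σ)
  refine ⟨s.appTop (artinSchreierCoord p hp a), ?_⟩
  rw [← map_pow, ← map_sub, artinSchreierCoord_pow_sub]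
  change (s ≫ (artinSchreierCover p hp a).toBase).appTop a = a
  rw [hs]
  rfl

end Eval

section Character

variable {U : Scheme.{u}} {Ω : Type u} [Field Ω] [IsSepClosed Ω] {ξ : Spec (.of Ω) ⟶ U}
  (p : ℕ) [Fact p.Prime] (hp : (p : Γ(U, ⊤)) = 0) (a : Γ(U, ⊤))

open PreGaloisCategory in
/-- The character of the fundamental group attached to an Artin–Schreier cover. It is continuous,
stated here as closedness of its kernel. -/
theorem exists_artinSchreierCharacter :
    ∃ χ : EtaleFundamentalGroup ξ →* Multiplicative (ZMod p),
      IsClosed (χ.ker : Set (EtaleFundamentalGroup ξ)) ∧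
      ∀ σ x, ((χ σ).toAdd.cast : Ω) = coordAt p hp a (σ.hom.app _ x) - coordAt p hp a x := by
  have hΩ := natCast_eq_zero_of_ringHom p (evalAt ξ) hp
  have : CharP Ω p := (CharP.charP_iff_prime_eq_zero Fact.out).mpr hΩ
  let ι : ZMod p →+* Ω := ZMod.castHom (dvd_refl p) Ω
  have hι : Function.Injective ι := ι.injective
  obtain ⟨x₀⟩ := nonempty_fibre_artinSchreierCover (ξ := ξ) p hp a
  let X := artinSchreierCover p hp a
  -- the translation by which `α` moves the base point, as an element of `𝔽_p`
  let n (α : Aut ((fibreFunctor ξ).obj X)) : ZMod p :=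
    Function.invFun ι (coordAt p hp a (α.hom x₀) - coordAt p hp a x₀)
  have hn (σ : Aut (fibreFunctor ξ)) (x : (fibreFunctor ξ).obj X) :
      ι (n (autEmbedding _ σ X)) = coordAt p hp a (σ.hom.app _ x) - coordAt p hp a x := by
    rw [coordAt_app_sub_coordAt p hp a σ.hom x x₀]
    apply Function.invFun_eq
    obtain ⟨m, hm⟩ := exists_intCast_eq_coordAt_sub p hp a (σ.hom.app _ x₀) x₀
    exact ⟨m, by rw [map_intCast, hm]; rfl⟩
  let χ : EtaleFundamentalGroup ξ →* Multiplicative (ZMod p) :=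
    MonoidHom.mk' (fun σ ↦ Multiplicative.ofAdd (n (autEmbedding _ σ X))) fun σ τ ↦ by
      rw [← ofAdd_add]
      congr 1
      apply hι
      rw [map_add, hn _ x₀, hn τ x₀, hn σ (τ.hom.app _ x₀), sub_add_sub_cancel]
      rfl
  refine ⟨χ, ?_, hn⟩
  have h : Continuous fun σ : Aut (fibreFunctor ξ) ↦ autEmbedding _ σ X :=
    (continuous_apply X).comp continuous_induced_dom
  exact (isClosed_discrete {α | Multiplicative.ofAdd (n α) = 1}).preimage h

/-- The quotient of `H⁰(U, 𝒪_U)` by the image of `r ↦ r ^ p - r` embeds into the dual of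
`π₁^ab ⊗ 𝔽_p`: if `a` and `b` have the same character, the difference of points of their covers is a
fixed point in the fibre of the cover attached to `a - b`. -/
theorem exists_separating_map (hp : (p : Γ(U, ⊤)) = 0) [ConnectedSpace U] :
    ∃ χ : Γ(U, ⊤) → (EtaleFundamentalGroupAb ξ ⊗[ℤ] ZMod p →+ ZMod p),
      ∀ a b, χ a = χ b → ∃ r : Γ(U, ⊤), r ^ p - r = a - b := by
  choose χ hχ hχ' using exists_artinSchreierCharacter (ξ := ξ) p hp
  have hker (a) : (commutator (EtaleFundamentalGroup ξ)).topologicalClosure ≤ (χ a).ker :=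
    Subgroup.topologicalClosure_minimal _ (Abelianization.commutator_subset_ker _) (hχ a)
  let ψ (a) : EtaleFundamentalGroupAb ξ →+ ZMod p :=
    MonoidHom.toAdditiveLeft (QuotientGroup.lift _ (χ a) (hker a))
  let Ψ (a) : EtaleFundamentalGroupAb ξ ⊗[ℤ] ZMod p →ₗ[ℤ] ZMod p :=
    LinearMap.mul' ℤ (ZMod p) ∘ₗ (ψ a).toIntLinearMap.rTensor (ZMod p)
  have hΨ (a) (σ : EtaleFundamentalGroup ξ) :
      Ψ a (Additive.ofMul (QuotientGroup.mk σ) ⊗ₜ 1) = (χ a σ).toAdd := by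
    exact mul_one (ψ a (Additive.ofMul (QuotientGroup.mk σ)))
  refine ⟨fun a ↦ (Ψ a).toAddMonoidHom, fun a b hab ↦ ?_⟩
  have heq (σ : EtaleFundamentalGroup ξ) : χ a σ = χ b σ := by
    have := DFunLike.congr_fun hab (Additive.ofMul (QuotientGroup.mk σ) ⊗ₜ 1)
    exact Multiplicative.toAdd.injective ((hΨ a σ).symm.trans (this.trans (hΨ b σ)))
  obtain ⟨x⟩ := nonempty_fibre_artinSchreierCover (ξ := ξ) p hp a
  obtain ⟨y⟩ := nonempty_fibre_artinSchreierCover (ξ := ξ) p hp b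
  obtain ⟨z, hz⟩ := exists_coordAt_eq_sub p hp a b x y
  apply exists_pow_sub_eq_of_forall_coordAt_eq p hp (a - b) z
  intro σ
  have hz1 := hz (𝟙 _)
  have hz2 := hz σ.hom
  have h1 := hχ' a σ x
  have h2 := hχ' b σ y
  rw [heq σ, h2] at h1
  simp only [NatTrans.id_app, FintypeCat.id_apply] at hz1
  rw [hz1, hz2]
  linear_combination -h1

end Character

end FiniteEtaleCover

/-! ### Linear independence of solutions of Artin–Schreier equations -/

section Independence

open Polynomial

variable (p : ℕ) [Fact p.Prime]

/-- Suppose `F` contains no solution of `λ ^ p - λ = c t` with `c ≠ 0` in `k`. Then solutions in an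
extension `L` of the equations `b ^ p - b = c t`, for `c` in an `𝔽_p`-independent family, are
linearly independent over `F`. In a shortest relation `∑ l_i b_i = d` with a coefficient equal to
`1`, subtracting the relation from its `p`-th power yields a shorter one, so that `l_i ∈ 𝔽_p` and
`d ^ p - d = (∑ l_i c_i) t`. -/
theorem linearIndependent_of_pow_sub_eq {k F L ι : Type*} [Field k] [Field F] [Field L]
    [CharP L p] [Algebra (ZMod p) k] [Algebra k F] [Algebra F L] (t : F)
    (ht : ∀ (c : k) (l : F), l ^ p - l = algebraMap k F c * t → c = 0)
    (c : ι → k) (hc : LinearIndependent (ZMod p) c) (b : ι → L)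
    (hb : ∀ i, b i ^ p - b i = algebraMap F L (algebraMap k F (c i) * t)) :
    LinearIndependent F b := by
  classical
  have : CharP F p := (RingHom.charP_iff (algebraMap F L) (algebraMap F L).injective p).mpr ‹_›
  suffices H : ∀ (s : Finset ι) (l : ι → F) (d : F),
      ∑ i ∈ s, algebraMap F L (l i) * b i = algebraMap F L d → ∀ i ∈ s, l i = 0 by
    refine linearIndependent_iff'.mpr fun s l hl ↦ H s l 0 ?_
    simpa [Algebra.smul_def] using hl
  intro s
  induction s using Finset.induction_on with
  | empty => simp
  | insert j s hj ih =>
    intro l d hl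
    by_cases hlj : l j = 0
    · rw [Finset.sum_insert hj, hlj, map_zero, zero_mul, zero_add] at hl
      exact Finset.forall_mem_insert _ _ _ |>.mpr ⟨hlj, ih l d hl⟩
    exfalso
    -- normalize the relation so that the coefficient of `b j` is `1`
    obtain ⟨l', d', hl'j, hl'⟩ : ∃ (l' : ι → F) (d' : F), l' j = 1 ∧
        ∑ i ∈ insert j s, algebraMap F L (l' i) * b i = algebraMap F L d' := by
      refine ⟨fun i ↦ (l j)⁻¹ * l i, (l j)⁻¹ * d, inv_mul_cancel₀ hlj, ?_⟩
      simp only [map_mul, mul_assoc, ← Finset.mul_sum, hl]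
    have hpow : ∑ i ∈ insert j s, (algebraMap F L (l' i ^ p) * b i +
        algebraMap F L (l' i ^ p * (algebraMap k F (c i) * t))) = algebraMap F L (d' ^ p) := by
      rw [map_pow, ← hl', sum_pow_char]
      refine Finset.sum_congr rfl fun i _ ↦ ?_
      rw [mul_pow, map_mul, ← hb, map_pow]
      ring
    have hfix : ∀ i ∈ s, l' i ^ p - l' i = 0 := by
      apply ih (fun i ↦ l' i ^ p - l' i)
        (d' ^ p - d' - ∑ i ∈ insert j s, l' i ^ p * (algebraMap k F (c i) * t))
      rw [Finset.sum_add_distrib] at hpow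
      have h : ∑ i ∈ insert j s, algebraMap F L (l' i ^ p - l' i) * b i =
          algebraMap F L (d' ^ p - d' -
            ∑ i ∈ insert j s, l' i ^ p * (algebraMap k F (c i) * t)) := by
        simp only [map_sub, sub_mul, Finset.sum_sub_distrib, map_sum, hl', ← hpow]
        ring
      rwa [Finset.sum_insert hj, hl'j, one_pow, sub_self, map_zero, zero_mul, zero_add] at h
    have hfix' : ∀ i ∈ insert j s, l' i ^ p = l' i :=
      (Finset.forall_mem_insert _ _ _).mpr ⟨by rw [hl'j, one_pow],
        fun i hi ↦ sub_eq_zero.mp (hfix i hi)⟩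
    have hint : ∀ i, ∃ n : ℤ, i ∈ insert j s → (n : F) = l' i := fun i ↦ by
      by_cases hi : i ∈ insert j s
      · obtain ⟨n, hn⟩ := (mem_bot_iff_intCast p F).mp
          ((Subfield.mem_bot_iff_pow_eq_self (F := F) (p := p)).mpr (hfix' i hi))
        exact ⟨n, fun _ ↦ hn⟩
      · exact ⟨0, fun h ↦ absurd h hi⟩
    choose n hn using hint
    have hsum : ∑ i ∈ insert j s, (n i : ZMod p) • c i = 0 := by
      apply ht _ d'
      have h1 : ∑ i ∈ insert j s, l' i ^ p * (algebraMap k F (c i) * t) = d' ^ p - d' := by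
        apply (algebraMap F L).injective
        rw [Finset.sum_add_distrib] at hpow
        rw [map_sub, ← hpow, ← hl', map_sum, eq_sub_iff_add_eq, add_comm, add_left_inj]
        exact Finset.sum_congr rfl fun i hi ↦ by rw [hfix' i hi]
      rw [← h1, map_sum, Finset.sum_mul]
      refine Finset.sum_congr rfl fun i hi ↦ ?_
      rw [hfix' i hi, ← hn i hi, Algebra.smul_def, map_mul, map_intCast, map_intCast, mul_assoc]
    have hz := linearIndependent_iff'.mp hc _ _ hsum j (Finset.mem_insert_self _ _)
    have h0 := hn j (Finset.mem_insert_self _ _)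
    obtain ⟨q, hq⟩ := (ZMod.intCast_zmod_eq_zero_iff_dvd _ p).mp hz
    rw [hl'j, hq] at h0
    simp at h0

/-- The Artin–Schreier equation `l ^ p - l = c X` has no solution in `k(X)` unless `c = 0`. -/
theorem eq_zero_of_pow_sub_eq_mul_X {k K : Type*} [Field k] [Field K] [Algebra k[X] K]
    [IsFractionRing k[X] K] (c : k) (l : K)
    (h : l ^ p - l = algebraMap k[X] K (C c * X)) : c = 0 := by
  have hp : 1 < p := (Fact.out : p.Prime).one_lt
  have hint : _root_.IsIntegral k[X] l := by
    refine ⟨X ^ p - X - C (C c * X), ?_, by simp [h]⟩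
    rw [sub_sub]
    refine monic_X_pow_sub (n := p) ((degree_add_le _ _).trans_lt (max_lt ?_ ?_))
    · exact degree_X_le.trans_lt (by exact_mod_cast hp)
    · exact degree_C_le.trans_lt (by exact_mod_cast hp.le)
  obtain ⟨q, rfl⟩ := IsIntegrallyClosed.isIntegral_iff.mp hint
  have hq : q ^ p - q = C c * X := by
    apply FaithfulSMul.algebraMap_injective k[X] K
    rw [← h, map_sub, map_pow]
  rcases Nat.eq_zero_or_pos q.natDegree with h0 | h0
  · rw [eq_C_of_natDegree_eq_zero h0, ← C_pow, ← C_sub] at hq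
    simpa only [coeff_C_succ, coeff_C_mul, coeff_X_one, mul_one]
      using (congrArg (coeff · 1) hq).symm
  · have h1 : (q ^ p - q).natDegree = p * q.natDegree := by
      rw [natDegree_sub_eq_left_of_natDegree_lt, natDegree_pow]
      rw [natDegree_pow]
      exact lt_mul_left h0 hp
    have h2 : (C c * X).natDegree ≤ 1 :=
      (natDegree_C_mul_le c X).trans natDegree_X_le
    rw [← hq, h1] at h2
    have := Nat.le_mul_of_pos_right p h0
    omega

/-- A finitely generated `k`-algebra containing a transcendental element `t` has a homomorphism to a
finite extension of `k(X)` that maps `t` to `X`: a closed point of the generic fibre of `t`. -/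
theorem exists_ringHom_finite_of_transcendental {k B : Type u} [Field k] [CommRing B] [Algebra k B]
    [Algebra.FiniteType k B] (t : B) (ht : Transcendental k t) :
    ∃ (L : Type u) (_ : Field L) (_ : Algebra (FractionRing k[X]) L) (φ : B →+* L),
      Module.Finite (FractionRing k[X]) L ∧
      ∀ q : k[X], φ (aeval t q) = algebraMap (FractionRing k[X]) L (algebraMap _ _ q) := by
  let : Algebra k[X] B := (aeval t).toAlgebra
  have : IsScalarTower k k[X] B := .of_algebraMap_eq fun r ↦ (aeval_C t r).symm
  have : Algebra.FiniteType k[X] B := .of_restrictScalars_finiteType k k[X] B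
  let K := FractionRing k[X]
  let T := K ⊗[k[X]] B
  have hinj : Function.Injective (algebraMap k[X] B) := transcendental_iff_injective.mp ht
  have : Module.Flat k[X] K := IsLocalization.flat K (nonZeroDivisors k[X])
  have : Nontrivial T :=
    (Algebra.TensorProduct.includeLeft_injective (R := k[X]) (S := K) (A := K) hinj).nontrivial
  obtain ⟨m, hm⟩ := Ideal.exists_maximal T
  let : Field (T ⧸ m) := Ideal.Quotient.field m
  refine ⟨T ⧸ m, inferInstance, inferInstance, (Ideal.Quotient.mk m).comp
    (Algebra.TensorProduct.includeRight : B →ₐ[k[X]] T).toRingHom,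
    finite_of_finite_type_of_isJacobsonRing K (T ⧸ m), fun q ↦ ?_⟩
  change Ideal.Quotient.mk m ((Algebra.TensorProduct.includeRight : B →ₐ[k[X]] T)
    (algebraMap k[X] B q)) = Ideal.Quotient.mk m (algebraMap K T (algebraMap k[X] K q))
  rw [AlgHom.commutes, ← IsScalarTower.algebraMap_apply]

/-- If `t` is transcendental over `k`, the equation `b ^ p - b = c t` is solvable in a finitely
generated `k`-algebra for only finitely many `c ∈ k`. -/
theorem finite_setOf_exists_pow_sub_eq {k B : Type u} [Field k] [CharP k p] [CommRing B]
    [Algebra k B] [Algebra.FiniteType k B] (t : B) (ht : Transcendental k t) :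
    {c : k | ∃ b : B, b ^ p - b = algebraMap k B c * t}.Finite := by
  obtain ⟨L, _, _, φ, _, hφ⟩ := exists_ringHom_finite_of_transcendental t ht
  let := ZMod.algebra k p
  set W := {c : k | ∃ b : B, b ^ p - b = algebraMap k B c * t}
  obtain ⟨S, hSW, hspan, hS⟩ := exists_linearIndependent (ZMod p) W
  choose b hb using fun c : S ↦ hSW c.2
  let i : k →+* L := (algebraMap (FractionRing k[X]) L).comp (algebraMap k _)
  have : CharP L p := (RingHom.charP_iff i i.injective p).mp ‹_›
  have hli : LinearIndependent (FractionRing k[X]) fun c ↦ φ (b c) := by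
    refine linearIndependent_of_pow_sub_eq p (k := k) (algebraMap k[X] _ X) ?_ _ hS _ fun c ↦ ?_
    · intro c l h
      apply eq_zero_of_pow_sub_eq_mul_X p c l
      rw [h, map_mul]
      rfl
    · rw [← map_pow, ← map_sub, hb]
      have := hφ (C (c : k) * X)
      rw [map_mul, aeval_C, aeval_X] at this
      rw [this, map_mul]
      rfl
  have : Finite S := hli.finite
  have hfin : Module.Finite (ZMod p) (Submodule.span (ZMod p) S) :=
    Module.Finite.span_of_finite _ (Set.toFinite S)
  have : Finite (Submodule.span (ZMod p) S) := Module.finite_of_finite (ZMod p)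
  refine Set.Finite.subset (Set.toFinite (Submodule.span (ZMod p) S : Set k)) ?_
  rw [hspan]
  exact Submodule.subset_span

end Independence

/-! ### Algebraic functions on a connected reduced scheme -/

section AlgebraicFunctions

open Polynomial

/-- Over an algebraically closed field, the only algebraic elements of a reduced algebra without
nontrivial idempotents are the constants: a root of the equation splits off an idempotent, which
either allows the degree to be lowered or shows that the element equals the root. -/
theorem mem_range_algebraMap_of_isAlgebraic {k A : Type*} [Field k] [IsAlgClosed k] [CommRing A]
    [Nontrivial A] [_root_.IsReduced A] [Algebra k A]
    (hA : ∀ e : A, IsIdempotentElem e → e = 0 ∨ e = 1) (t : A) (P : k[X]) (hP : P ≠ 0)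
    (hPt : aeval t P = 0) : t ∈ (algebraMap k A).range := by
  induction hn : P.natDegree using Nat.strong_induction_on generalizing P with
  | _ n ih =>
  subst hn
  have hdeg : P.degree ≠ 0 := by
    intro h
    rw [eq_C_of_degree_eq_zero h, aeval_C, map_eq_zero_iff _ (algebraMap k A).injective] at hPt
    rw [eq_C_of_degree_eq_zero h, hPt, C_0] at hP
    exact hP rfl
  obtain ⟨a, ha⟩ := IsAlgClosed.exists_root P hdeg
  obtain ⟨Q, hPQ, hQ⟩ := exists_eq_pow_rootMultiplicity_mul_and_not_dvd P hP a
  have hm : 0 < rootMultiplicity a P := (rootMultiplicity_pos hP).mpr ha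
  set m := rootMultiplicity a P
  have hQ0 : Q ≠ 0 := fun h ↦ hQ (h ▸ dvd_zero _)
  obtain ⟨u, v, huv⟩ : IsCoprime ((X - C a) ^ m) Q :=
    IsCoprime.pow_left (((irreducible_X_sub_C a).coprime_iff_not_dvd).mpr hQ)
  have huv' : aeval t u * (t - algebraMap k A a) ^ m + aeval t v * aeval t Q = 1 := by
    simpa using congrArg (aeval t) huv
  have hPt' : (t - algebraMap k A a) ^ m * aeval t Q = 0 := by
    rw [← hPt]
    conv_rhs => rw [hPQ]
    simp
  rcases hA (aeval t v * aeval t Q) (by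
    rw [IsIdempotentElem]
    linear_combination (aeval t v * aeval t Q) * huv' - aeval t u * aeval t v * hPt') with h | h
  · refine ih Q.natDegree ?_ Q hQ0 ?_ rfl
    · rw [hPQ, natDegree_mul (pow_ne_zero _ (X_sub_C_ne_zero a)) hQ0, natDegree_pow,
        natDegree_X_sub_C]
      omega
    · linear_combination -(aeval t Q) * huv' + aeval t u * hPt' + aeval t Q * h
  · have h0 : (t - algebraMap k A a) ^ m = 0 := by
      linear_combination -(t - algebraMap k A a) ^ m * h + aeval t v * hPt'
    exact ⟨a, (sub_eq_zero.mp (pow_eq_zero_iff hm.ne' |>.mp h0)).symm⟩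

theorem eq_zero_or_eq_one_of_isIdempotentElem {U : Scheme.{u}} [ConnectedSpace U] [IsReduced U]
    (e : Γ(U, ⊤)) (he : IsIdempotentElem e) : e = 0 ∨ e = 1 := by
  have hsup : U.basicOpen e ⊔ U.basicOpen (1 - e) = ⊤ := by
    rw [eq_top_iff]
    refine le_trans ?_ (U.basicOpen_add_le e (1 - e))
    rw [add_sub_cancel, U.basicOpen_of_isUnit isUnit_one]
  have hinf : U.basicOpen e ⊓ U.basicOpen (1 - e) = ⊥ := by
    rw [← Scheme.basicOpen_mul, he.mul_one_sub_self, Scheme.basicOpen_zero]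
  have hc : IsCompl (U.basicOpen e) (U.basicOpen (1 - e)) := IsCompl.of_eq hinf hsup
  have hclopen : IsClopen (U.basicOpen e : Set U) := by
    refine ⟨?_, (U.basicOpen e).isOpen⟩
    have : (U.basicOpen e : Set U) = (U.basicOpen (1 - e) : Set U)ᶜ := by
      refine (compl_unique ?_ ?_).symm
      · rw [inf_comm]; exact congrArg SetLike.coe hinf
      · rw [sup_comm]; exact congrArg SetLike.coe hsup
    rw [this]
    exact (U.basicOpen (1 - e)).isOpen.isClosed_compl
  rcases isClopen_iff.mp hclopen with h | h
  · left
    exact eq_zero_of_basicOpen_eq_bot e (SetLike.coe_injective h)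
  · right
    have h' : U.basicOpen e = ⊤ := SetLike.coe_injective h
    rw [h', top_inf_eq] at hinf
    exact (sub_eq_zero.mp (eq_zero_of_basicOpen_eq_bot _ hinf)).symm

theorem nontrivial_Γ_top {U : Scheme.{u}} [Nonempty U] : Nontrivial Γ(U, ⊤) :=
  have : Nonempty (⊤ : U.Opens) := ‹Nonempty U›.map fun x ↦ ⟨x, trivial⟩
  U.component_nontrivial ⊤

/-- A function on a quasi-compact scheme that is algebraic over `k` on every affine open is
algebraic over `k`. -/
theorem exists_eval₂_eq_zero {U : Scheme.{u}} [CompactSpace U] {k : Type u} [Field k]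
    (φ : k →+* Γ(U, ⊤)) (t : Γ(U, ⊤))
    (h : ∀ V : U.affineOpens, ∃ P : k[X], P ≠ 0 ∧
      U.presheaf.map (homOfLE le_top : V.1 ⟶ ⊤).op (P.eval₂ φ t) = 0) :
    ∃ P : k[X], P ≠ 0 ∧ P.eval₂ φ t = 0 := by
  suffices H : ∃ P : k[X], P ≠ 0 ∧
      U.presheaf.map (homOfLE le_top : (⊤ : U.Opens) ⟶ ⊤).op (P.eval₂ φ t) = 0 by
    obtain ⟨P, hP, hPt⟩ := H
    exact ⟨P, hP, by simpa using hPt⟩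
  refine compact_open_induction_on (P := fun V : U.Opens ↦ ∃ P : k[X], P ≠ 0 ∧
    U.presheaf.map (homOfLE le_top : V ⟶ ⊤).op (P.eval₂ φ t) = 0) ⊤ isCompact_univ ?_ ?_
  · refine ⟨1, one_ne_zero, ?_⟩
    exact Subsingleton.elim _ _
  · rintro S _ V ⟨P, hP, hPt⟩
    obtain ⟨Q, hQ, hQt⟩ := h V
    refine ⟨P * Q, mul_ne_zero hP hQ, ?_⟩
    rw [eval₂_mul]
    refine U.sheaf.eq_of_locally_eq₂ (homOfLE le_sup_left : S ⟶ S ⊔ V.1)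
      (homOfLE le_sup_right : V.1 ⟶ S ⊔ V.1) le_rfl _ _ ?_ ?_
    · change U.presheaf.map _ (U.presheaf.map _ _) = U.presheaf.map _ _
      rw [map_zero, map_mul, map_mul, ← CommRingCat.comp_apply, ← Functor.map_comp]
      refine (congrArg (· * _) hPt).trans (zero_mul _)
    · change U.presheaf.map _ (U.presheaf.map _ _) = U.presheaf.map _ _
      rw [map_zero, mul_comm, map_mul, map_mul, ← CommRingCat.comp_apply, ← Functor.map_comp]
      refine (congrArg (· * _) hQt).trans (zero_mul _)

end AlgebraicFunctions

/-! ### Finiteness of the dual of the fundamental group and global functions -/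

open FiniteEtaleCover

section

open Polynomial

/-- A global function `t` for which `b ^ p - b = c t` is solvable for infinitely many constants `c`
is itself constant. -/
theorem mem_range_of_infinite_setOf_exists_pow_sub_eq (p : ℕ) [Fact p.Prime] {k : Type u} [Field k]
    [IsAlgClosed k] [CharP k p] {U : Scheme.{u}} (f : U ⟶ Spec (.of k)) [LocallyOfFiniteType f]
    [QuasiCompact f] [ConnectedSpace U] [IsReduced U] (t : Γ(U, ⊤))
    (ht : {c : k | ∃ b : Γ(U, ⊤), b ^ p - b = globalStructureMap f c * t}.Infinite) :
    t ∈ (globalStructureMap f).range := by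
  have : CompactSpace U := by
    have := (quasiCompact_iff_compactSpace (f := f)).mp inferInstance
    exact this
  obtain ⟨P, hP, hPt⟩ := exists_eval₂_eq_zero (globalStructureMap f) t fun V ↦ by
    by_contra! hV
    apply ht
    let r := U.presheaf.map (homOfLE le_top : V.1 ⟶ ⊤).op
    let := (r.hom.comp (globalStructureMap f)).toAlgebra
    have : Algebra.FiniteType k Γ(U, V.1) := by
      have h1 : (f.appLE ⊤ V.1 le_top).hom.FiniteType :=
        LocallyOfFiniteType.finiteType_appLE f (isAffineOpen_top _) V.2 _
      have h2 : (Scheme.ΓSpecIso (.of k)).inv.hom.FiniteType :=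
        RingHom.FiniteType.of_surjective _
          (ConcreteCategory.bijective_of_isIso (Scheme.ΓSpecIso (.of k)).inv).2
      exact h1.comp h2
    refine (finite_setOf_exists_pow_sub_eq p (r.hom t) ?_).subset ?_
    · rw [transcendental_iff]
      intro Q hQ
      by_contra hQ0
      apply hV Q hQ0
      rw [← hQ]
      exact Polynomial.hom_eval₂ Q (globalStructureMap f) r.hom t
    · rintro c ⟨b, hb⟩
      refine ⟨r.hom b, ?_⟩
      rw [← map_pow, ← map_sub, hb, map_mul]
      rfl
  have : Nontrivial Γ(U, ⊤) := nontrivial_Γ_top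
  let := (globalStructureMap f).toAlgebra
  exact mem_range_algebraMap_of_isAlgebraic eq_zero_or_eq_one_of_isIdempotentElem t P hP hPt
end

theorem proposition3
    -- an algebraically closed field of characteristic `p > 0`
    (p : ℕ) [Fact p.Prime] (k : Type u) [Field k] [IsAlgClosed k] [CharP k p]
    -- a connected (in particular non-empty) reduced variety `f : U → Spec k`
    (U : Scheme.{u}) (f : U ⟶ Spec (.of k))
    [IsSeparated f] [LocallyOfFiniteType f] [QuasiCompact f]
    [ConnectedSpace U] [IsReduced U]
    -- a geometric base point
    (Ω : Type u) [Field Ω] [IsSepClosed Ω] (ξ : Spec (.of Ω) ⟶ U)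
    (hfin : Finite (EtaleFundamentalGroupAb ξ ⊗[ℤ] ZMod p)) :
    Function.Bijective (globalStructureMap f) := by
  have : Nontrivial Γ(U, ⊤) := nontrivial_Γ_top
  refine ⟨(globalStructureMap f).injective, fun t ↦ ?_⟩
  apply mem_range_of_infinite_setOf_exists_pow_sub_eq p f t
  have hp : (p : Γ(U, ⊤)) = 0 :=
    natCast_eq_zero_of_ringHom p (globalStructureMap f) (CharP.cast_eq_zero k p)
  obtain ⟨χ, hχ⟩ := exists_separating_map (ξ := ξ) p hp
  have : Finite (EtaleFundamentalGroupAb ξ ⊗[ℤ] ZMod p →+ ZMod p) :=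
    Finite.of_injective _ DFunLike.coe_injective
  have : Infinite k := IsAlgClosed.instInfinite
  obtain ⟨y, hy⟩ := Finite.exists_infinite_fiber fun c : k ↦ χ (globalStructureMap f c * t)
  obtain ⟨c₀, hc₀⟩ := hy.nonempty
  have hinj : Function.Injective fun c : k ↦ c - c₀ := sub_left_injective
  refine ((Set.infinite_coe_iff.mp hy).image hinj.injOn).mono ?_
  rintro _ ⟨c, hc, rfl⟩
  obtain ⟨r, hr⟩ := hχ _ _ ((hc : _ = y).trans (hc₀ : _ = y).symm)
  exact ⟨r, by rw [hr, map_sub, sub_mul]⟩
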